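/- Let $n\ge 0$ be an integer, let $\mathcal Y$ be a set of labels, let $U_n$ be the uniform distribution over $\{0,1\}^n$, and let $\mathsf{HD}$ be the Hamming distance. Let $\mathcal C$ (concepts) and $\mathcal H$ (hypotheses) be classes of functions $\{0,1\}^n\to\mathcal Y$, so that $\mathsf P=(\{0,1\}^n,\mathcal Y,U_n,\mathcal C,\mathcal H,\mathsf{HD})$ is a classification problem. For $h\in\mathcal H$ and $c\in\mathcal C$, the risk is $\mathsf{Risk}(h,c)=\Pr_{x\gets U_n}[h(x)\ne c(x)]$, and the error-region robustness is the expected Hamming distance to the error region, $$\mathsf{Rob}^{\mathrm{ER}}(h,c)=\mathbb E_{x\gets U_n}\Big[\inf\{r\ge 0:\ \exists x',\ \mathsf{HD}(x,x')\le r,\ h(x')\ne c(x')\}\Big]\in[0,\infty].$$ For integers $k\ge 0$ and real $\lambda$ put $$\mathsf{BSize}(k,\lambda)=2^{-n}\Big(\sum_{i=0}^{k-1}\binom ni+\lambda\binom nk\Big).$$ This function maps $\{0,\dots,n\}\times[0,1)$ bijectively onto $[0,1)$, and $\mathsf{BSize}(n+1,0)=1$. For $\mu\in[0,1]$ let $\mathsf{BSize}^{-1}(\mu)$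 be the unique $(k,\lambda)\in(\{0,\dots,n\}\times[0,1))\cup\{(n+1,0)\}$ with $\mathsf{BSize}(k,\lambda)=\mu$. Theorem. For every $h\in\mathcal H$ and $c\in\mathcal C$ with $\mu=\mathsf{Risk}(h,c)>0$, if $(k,\lambda)=\mathsf{BSize}^{-1}(\mu)$, then $$\mathsf{Rob}^{\mathrm{ER}}(h,c)\ \le\ \sum_{r=0}^{n-k+1}\bigl(1-\mathsf{BSize}(k+r,\lambda)\bigr).$$ -/

import Mathlib

open MeasureTheory
open scoped NNReal ENNReal

noncomputable section

/-- The Boolean hypercube `{0,1}^n`, with Mathlib's Hamming metric. -/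
abbrev Cube (n : ℕ) : Type := Hamming (fun _ : Fin n => Bool)

/-- Every subset of the (finite) hypercube is an event. -/
instance Cube.instMeasurableSpace (n : ℕ) : MeasurableSpace (Cube n) := ⊤

instance Cube.instDiscreteMeasurableSpace (n : ℕ) : DiscreteMeasurableSpace (Cube n) :=
  ⟨fun _ => trivial⟩

instance Cube.instNonempty (n : ℕ) : Nonempty (Cube n) := ⟨Hamming.toHamming fun _ => false⟩

/-- The uniform distribution `U_n` over `{0,1}^n`. -/
def uniformCube (n : ℕ) : Measure (Cube n) := (PMF.uniformOfFintype (Cube n)).toMeasure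

/-- A classification problem `(X, Y, D, C, H, d)`: a distribution `D` on the metric space of
instances `X`, a class `C` of concept functions and a class `H` of hypotheses, both consisting of
maps from instances to labels. -/
structure ClassificationProblem (X : Type*) (Y : Type*) [MetricSpace X] [MeasurableSpace X] where
  distribution : Measure X
  isProbabilityMeasure : IsProbabilityMeasure distribution
  concepts : Set (X → Y)
  hypotheses : Set (X → Y)

namespace ClassificationProblem

variable {X : Type*} {Y : Type*} [MetricSpace X] [MeasurableSpace X]

/-- `Risk(h,c) = Pr_{x ← D}[h(x) ≠ c(x)]`. -/
def risk (P : ClassificationProblem X Y) (h c : X → Y) : ℝ :=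
  P.distribution.real {x | h x ≠ c x}

/-- `inf {r ≥ 0 : ∃ x' ∈ Ball_r(x), h(x') ≠ c(x')}`, equal to `∞` if there is no such `r`. -/
def errorDist (h c : X → Y) (x : X) : ℝ≥0∞ :=
  ⨅ (r : ℝ≥0) (_ : ∃ x' ∈ Metric.closedBall x (r : ℝ), h x' ≠ c x'), (r : ℝ≥0∞)

/-- Error-region robustness: the expected distance of a sampled instance to the error region. -/
def robER (P : ClassificationProblem X Y) (h c : X → Y) : ℝ≥0∞ :=
  ∫⁻ x, errorDist h c x ∂P.distribution

end ClassificationProblem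

/-- The size of the partial Hamming ball:
`BSize_n(k, l) = 2^{-n} (∑_{i=0}^{k-1} C(n,i) + l C(n,k))`. -/
def BSize (n k : ℕ) (l : ℝ) : ℝ :=
  ((2 : ℝ) ^ n)⁻¹ * (∑ i ∈ Finset.range k, (n.choose i : ℝ) + l * (n.choose k : ℝ))

/-- The pairs `(k, l)` with `k ∈ {0, …, n}` and `l ∈ [0,1)`, on which `BSize n` is a bijection onto
`[0,1)`, together with the pair `(n+1, 0)`, where `BSize n` is `1`. -/
def BSizeDomain (n : ℕ) : Set (ℕ × ℝ) :=
  {p | p.1 ≤ n ∧ p.2 ∈ Set.Ico (0 : ℝ) 1} ∪ {(n + 1, 0)}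

theorem BSize_mono_zero (n : ℕ) {j k : ℕ} (h : j ≤ k) : BSize n j 0 ≤ BSize n k 0 := by
  unfold BSize
  simp only [zero_mul, add_zero]
  gcongr

theorem BSize_succ_zero (n k : ℕ) (l : ℝ) :
    BSize n (k + 1) 0 = BSize n k l + ((2 : ℝ) ^ n)⁻¹ * ((1 - l) * (n.choose k : ℝ)) := by
  unfold BSize
  rw [Finset.sum_range_succ]
  ring

theorem BSize_eq_add (n k : ℕ) (l : ℝ) :
    BSize n k l = BSize n k 0 + ((2 : ℝ) ^ n)⁻¹ * (l * (n.choose k : ℝ)) := by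
  unfold BSize
  ring

theorem BSize_top (n : ℕ) : BSize n (n + 1) 0 = 1 := by
  have h : ∑ i ∈ Finset.range (n + 1), (n.choose i : ℝ) = 2 ^ n := by
    exact_mod_cast Nat.sum_range_choose n
  unfold BSize
  rw [h]
  simp

theorem BSize_lt_succ (n k : ℕ) (l : ℝ) (hk : k ≤ n) (hl : l < 1) :
    BSize n k l < BSize n (k + 1) 0 := by
  rw [BSize_succ_zero n k l]
  have h1 : (0 : ℝ) < n.choose k := by exact_mod_cast Nat.choose_pos hk
  have h2 : 0 < 1 - l := by linarith
  have h3 : 0 < ((2 : ℝ) ^ n)⁻¹ * ((1 - l) * (n.choose k : ℝ)) := by positivity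
  linarith

theorem BSize_zero_le (n k : ℕ) (l : ℝ) (hl : 0 ≤ l) : BSize n k 0 ≤ BSize n k l := by
  rw [BSize_eq_add n k l]
  have h3 : 0 ≤ ((2 : ℝ) ^ n)⁻¹ * (l * (n.choose k : ℝ)) := by positivity
  linarith

theorem BSizeDomain_nonneg {n : ℕ} {p : ℕ × ℝ} (hp : p ∈ BSizeDomain n) : 0 ≤ p.2 := by
  rcases hp with hp | rfl
  · exact hp.2.1
  · exact le_rfl

theorem BSize_lt_of_lt {n : ℕ} {p q : ℕ × ℝ} (hp : p ∈ BSizeDomain n) (hq : q ∈ BSizeDomain n)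
    (h : p.1 < q.1) : BSize n p.1 p.2 < BSize n q.1 q.2 := by
  have hq1 : q.1 ≤ n + 1 := by
    rcases hq with hq | rfl
    · exact hq.1.trans n.le_succ
    · exact le_rfl
  rcases hp with hp | rfl
  · exact (BSize_lt_succ n _ _ hp.1 hp.2.2).trans_le
      ((BSize_mono_zero n h).trans (BSize_zero_le n _ _ (BSizeDomain_nonneg hq)))
  · simp only at h
    omega

/-- `BSize n` is a bijection from its domain onto `[0,1]`. -/
theorem BSize_bijOn (n : ℕ) :
    Set.BijOn (fun p : ℕ × ℝ => BSize n p.1 p.2) (BSizeDomain n) (Set.Icc 0 1) := by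
  refine ⟨?_, ?_, ?_⟩
  · intro p hp
    have h0 : BSize n 0 0 = 0 := by simp [BSize]
    constructor
    · calc (0 : ℝ) = BSize n 0 0 := h0.symm
        _ ≤ BSize n p.1 0 := BSize_mono_zero n (Nat.zero_le _)
        _ ≤ _ := BSize_zero_le n _ _ (BSizeDomain_nonneg hp)
    · rcases hp with hp | rfl
      · exact (BSize_lt_succ n _ _ hp.1 hp.2.2).le.trans
          ((BSize_mono_zero n (Nat.succ_le_succ hp.1)).trans (BSize_top n).le)
      · exact (BSize_top n).le
  · intro p hp q hq hpq
    simp only at hpq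
    rcases lt_trichotomy p.1 q.1 with h | h | h
    · exact absurd hpq (BSize_lt_of_lt hp hq h).ne
    · refine Prod.ext h ?_
      rcases hp with hp | rfl
      · rcases hq with hq | rfl
        · rw [← h, BSize_eq_add n p.1 p.2, BSize_eq_add n p.1 q.2] at hpq
          have h1 : (n.choose p.1 : ℝ) ≠ 0 := by exact_mod_cast (Nat.choose_pos hp.1).ne'
          have h2 : ((2 : ℝ) ^ n)⁻¹ ≠ 0 := by positivity
          exact mul_right_cancel₀ h1 (mul_left_cancel₀ h2 (add_left_cancel hpq))
        · have := hp.1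
          simp only at h
          omega
      · rcases hq with hq | rfl
        · have := hq.1
          simp only at h
          omega
        · rfl
    · exact absurd hpq (BSize_lt_of_lt hq hp h).ne'
  · intro m hm
    rcases hm.2.eq_or_lt with rfl | hm1
    · exact ⟨(n + 1, 0), Or.inr rfl, BSize_top n⟩
    have hex : ∃ j, m < BSize n (j + 1) 0 := ⟨n, by rw [BSize_top]; exact hm1⟩
    classical
    set k := Nat.find hex with hk
    have hk1 : m < BSize n (k + 1) 0 := Nat.find_spec hex
    have hkn : k ≤ n := Nat.find_min' hex (by rw [BSize_top]; exact hm1)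
    have hk0 : BSize n k 0 ≤ m := by
      rcases Nat.eq_zero_or_pos k with h | h
      · rw [h]
        simpa [BSize] using hm.1
      · have := Nat.find_min hex (m := k - 1) (by omega)
        rw [Nat.sub_add_cancel h] at this
        exact not_lt.1 this
    have hc : (0 : ℝ) < n.choose k := by exact_mod_cast Nat.choose_pos hkn
    have hd : (0 : ℝ) < ((2 : ℝ) ^ n)⁻¹ * n.choose k := by positivity
    rw [BSize_succ_zero n k 0] at hk1
    refine ⟨(k, (m - BSize n k 0) / (((2 : ℝ) ^ n)⁻¹ * n.choose k)),
      Or.inl ⟨hkn, div_nonneg (by linarith) hd.le, ?_⟩, ?_⟩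
    · rw [div_lt_one hd]
      linarith
    · simp only
      rw [BSize_eq_add]
      field_simp
      ring

/-- The inverse of the bijection `BSize n : BSizeDomain n → [0,1]`. -/
def BSizeInv (n : ℕ) (m : ℝ) : ℕ × ℝ :=
  Function.invFunOn (fun p : ℕ × ℝ => BSize n p.1 p.2) (BSizeDomain n) m

/-- `BSizeInv n m = (k, l)` means exactly `(k, l) ∈ BSizeDomain n` and `BSize n k l = m`. -/
theorem BSizeInv_eq_iff (n : ℕ) {m : ℝ} (hm : m ∈ Set.Icc (0 : ℝ) 1) (k : ℕ) (l : ℝ) :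
    (k, l) = BSizeInv n m ↔ (k, l) ∈ BSizeDomain n ∧ BSize n k l = m := by
  have hb := BSize_bijOn n
  have hmem : BSizeInv n m ∈ BSizeDomain n := Function.invFunOn_mem (hb.surjOn hm)
  have heq : BSize n (BSizeInv n m).1 (BSizeInv n m).2 = m :=
    Function.invFunOn_eq (hb.surjOn hm)
  constructor
  · intro h
    rw [← h] at hmem heq
    exact ⟨hmem, heq⟩
  · rintro ⟨h1, h2⟩
    exact hb.injOn h1 hmem (h2.trans heq.symm)

end

/-! Let `A` be the error region and `A_r` the set of points within distance `r` of it. The distance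
to `A` is the sum over `r` of the indicators of the complement of `A_r`, so its expectation is the
sum of `1 - |A_r| / 2^n`. It remains to show that `|A_r|` is at least the size `B_n(k + r, l)` of a
partial ball when `|A| = B_n(k, l)`. By iteration this reduces to one step, `growth n |A| ≤ |A_1|`
(`growth_card_le_card_thickening`), where `growth n` sends `B_n(k, l)` to `B_n(k + 1, l)`.

The function `growth n` is concave because its slopes `C(n,k+1) / C(n,k) = (n-k)/(k+1)` decrease in
`k`. The one-step bound goes by induction on `n`. Cut `A` along a coordinate into sections of sizes
`x ≥ y`. Each section of `A_1` contains both the thickening of the same section of `A` and the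
opposite section of `A`, so `|A_1| ≥ growth n x + max (growth n y) x`. The two-point inequality
`growth_succ_le` bounds this below by `growth (n + 1) (x + y)`, using Pascal's rule and concavity.
-/

noncomputable section

/-! ### Sizes of partial Hamming balls. -/

/-- The number of points of `{0,1}^n` of weight less than `k`, plus a fraction `l` of those of
weight `k`. -/
def partialBallCard (n k : ℕ) (l : ℝ) : ℝ :=
  ∑ i ∈ Finset.range k, (n.choose i : ℝ) + l * (n.choose k : ℝ)

theorem partialBallCard_one (n k : ℕ) : partialBallCard n k 1 = partialBallCard n (k + 1) 0 := by
  simp [partialBallCard, Finset.sum_range_succ]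

theorem partialBallCard_mono_zero (n : ℕ) {j k : ℕ} (h : j ≤ k) :
    partialBallCard n j 0 ≤ partialBallCard n k 0 := by
  unfold partialBallCard
  simp only [zero_mul, add_zero]
  gcongr

theorem partialBallCard_eq_add (n k : ℕ) (l : ℝ) :
    partialBallCard n k l = partialBallCard n k 0 + l * (n.choose k : ℝ) := by
  simp [partialBallCard]

theorem partialBallCard_zero_le (n k : ℕ) {l : ℝ} (hl : 0 ≤ l) :
    partialBallCard n k 0 ≤ partialBallCard n k l := by
  rw [partialBallCard_eq_add n k l]
  have : 0 ≤ l * (n.choose k : ℝ) := by positivity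
  linarith

theorem partialBallCard_le_succ (n k : ℕ) {l : ℝ} (hl : l ≤ 1) :
    partialBallCard n k l ≤ partialBallCard n (k + 1) 0 := by
  rw [← partialBallCard_one, partialBallCard, partialBallCard]
  gcongr

theorem partialBallCard_eq_BSize (n k : ℕ) (l : ℝ) :
    partialBallCard n k l = 2 ^ n * BSize n k l := by
  unfold BSize partialBallCard
  field_simp

theorem partialBallCard_succ_top (n : ℕ) (l : ℝ) : partialBallCard n (n + 1) l = 2 ^ n := by
  have := partialBallCard_eq_BSize n (n + 1) 0
  rw [BSize_top, mul_one] at this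
  rw [partialBallCard_eq_add, this]
  simp

/-- Pascal's rule, summed. -/
theorem partialBallCard_pascal (n k : ℕ) (l : ℝ) :
    partialBallCard (n + 1) (k + 1) l = partialBallCard n k l + partialBallCard n (k + 1) l := by
  have h : ∑ i ∈ Finset.range (k + 1), ((n + 1).choose i : ℝ) =
      ∑ i ∈ Finset.range k, (n.choose i : ℝ) + ∑ i ∈ Finset.range (k + 1), (n.choose i : ℝ) := by
    rw [Finset.sum_range_succ', Finset.sum_range_succ' (fun i => (n.choose i : ℝ)) k]
    simp only [Nat.choose_succ_succ', Nat.cast_add, Finset.sum_add_distrib, Nat.choose_zero_right]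
    ring
  unfold partialBallCard
  rw [h, Nat.choose_succ_succ']
  push_cast
  ring

/-- Every real number in `[0, 2^n]` is the size of a partial ball. -/
theorem exists_partialBallCard_eq (n : ℕ) {x : ℝ} (h0 : 0 ≤ x) (h1 : x ≤ 2 ^ n) :
    ∃ k ≤ n, ∃ l ∈ Set.Icc (0 : ℝ) 1, partialBallCard n k l = x := by
  have hp : (0 : ℝ) < 2 ^ n := by positivity
  obtain ⟨⟨k, l⟩, hd, hkl⟩ := (BSize_bijOn n).surjOn
    (show x / 2 ^ n ∈ Set.Icc (0 : ℝ) 1 from ⟨by positivity, (div_le_one hp).2 h1⟩)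
  simp only at hkl
  have hx : partialBallCard n k l = x := by
    rw [partialBallCard_eq_BSize, hkl]
    field_simp
  rcases hd with hd | hd
  · exact ⟨k, hd.1, l, ⟨hd.2.1, hd.2.2.le⟩, hx⟩
  · obtain ⟨rfl, rfl⟩ := Prod.mk.inj hd
    -- The whole cube is written as radius `n` with fraction `1`, keeping the radius at most `n`, as
    -- `growth_partialBallCard` requires.
    exact ⟨n, le_rfl, 1, by simp, by rw [partialBallCard_one, hx]⟩

/-! ### The concave growth function and the two-point inequality. -/

/-- The slope `C(n,k+1) / C(n,k)`. -/
def growthSlope (n k : ℕ) : ℝ := ((n - k : ℕ) : ℝ) / (k + 1)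

theorem growthSlope_nonneg (n k : ℕ) : 0 ≤ growthSlope n k := by
  unfold growthSlope
  positivity

theorem growthSlope_succ_le (n k : ℕ) : growthSlope n (k + 1) ≤ growthSlope n k := by
  unfold growthSlope
  have : n - (k + 1) ≤ n - k := by omega
  push_cast
  gcongr
  linarith

theorem choose_mul_growthSlope (n k : ℕ) :
    (n.choose k : ℝ) * growthSlope n k = n.choose (k + 1) := by
  have h : (n.choose (k + 1) : ℝ) * (k + 1) = n.choose k * ((n - k : ℕ) : ℝ) := by
    exact_mod_cast Nat.choose_succ_right_eq n k
  unfold growthSlope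
  field_simp
  linarith

/-- The line that carries the partial balls of radius `k` to those of radius `k + 1`. -/
def growthLine (n k : ℕ) (x : ℝ) : ℝ :=
  partialBallCard n (k + 1) 0 + (x - partialBallCard n k 0) * growthSlope n k

theorem growthLine_mono (n k : ℕ) : Monotone (growthLine n k) := fun x y h => by
  have := growthSlope_nonneg n k
  unfold growthLine
  gcongr

theorem growthLine_partialBallCard (n k : ℕ) (l : ℝ) :
    growthLine n k (partialBallCard n k l) = partialBallCard n (k + 1) l := by
  rw [growthLine, partialBallCard_eq_add n k l, partialBallCard_eq_add n (k + 1) l,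
    ← choose_mul_growthSlope]
  ring

/-- Consecutive lines cross at the size of a full ball, since fraction `1` at radius `k` is fraction
`0` at radius `k + 1`. As slopes decrease, line `k` is therefore the lowest one between the sizes of
the full balls it interpolates. -/
theorem growthLine_sub_succ (n k : ℕ) (x : ℝ) :
    growthLine n k x - growthLine n (k + 1) x =
      (x - partialBallCard n (k + 1) 0) * (growthSlope n k - growthSlope n (k + 1)) := by
  have h := growthLine_partialBallCard n k 1
  rw [partialBallCard_one, partialBallCard_one] at h
  unfold growthLine at *
  linarith

theorem growthLine_le_of_ge (n : ℕ) {k j : ℕ} (hkj : k ≤ j) {x : ℝ}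
    (hx : x ≤ partialBallCard n (k + 1) 0) : growthLine n k x ≤ growthLine n j x := by
  induction j, hkj using Nat.le_induction with
  | base => exact le_rfl
  | succ j hj ih =>
    have h1 := growthLine_sub_succ n j x
    have h2 := partialBallCard_mono_zero n (Nat.succ_le_succ hj)
    have h3 := growthSlope_succ_le n j
    have h4 : (x - partialBallCard n (j + 1) 0) * (growthSlope n j - growthSlope n (j + 1)) ≤ 0 :=
      mul_nonpos_of_nonpos_of_nonneg (by linarith) (by linarith)
    linarith

theorem growthLine_le_of_le (n : ℕ) {k j : ℕ} (hjk : j ≤ k) {x : ℝ}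
    (hx : partialBallCard n k 0 ≤ x) : growthLine n k x ≤ growthLine n j x := by
  induction k, hjk using Nat.le_induction with
  | base => exact le_rfl
  | succ k hk ih =>
    have h1 := growthLine_sub_succ n k x
    have h2 := partialBallCard_mono_zero n (Nat.le_succ k)
    have h3 := growthSlope_succ_le n k
    have h4 : 0 ≤ (x - partialBallCard n (k + 1) 0) * (growthSlope n k - growthSlope n (k + 1)) :=
      mul_nonneg (by linarith) (by linarith)
    linarith [ih (h2.trans hx)]

/-- The concave piecewise linear function that sends the size of a partial ball of radius `k` to
the size of the partial ball of radius `k + 1`. -/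
def growth (n : ℕ) (x : ℝ) : ℝ :=
  (Finset.range (n + 1)).inf' Finset.nonempty_range_add_one (fun k => growthLine n k x)

theorem growth_le_growthLine {n k : ℕ} (hk : k ≤ n) (x : ℝ) : growth n x ≤ growthLine n k x :=
  Finset.inf'_le _ (by simp; omega)

theorem exists_growth_eq (n : ℕ) (x : ℝ) : ∃ k ≤ n, growth n x = growthLine n k x := by
  obtain ⟨k, hk, h⟩ := Finset.exists_mem_eq_inf' (Finset.nonempty_range_add_one (n := n))
    (fun k => growthLine n k x)
  exact ⟨k, by simp at hk; omega, h⟩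

theorem growth_mono (n : ℕ) : Monotone (growth n) := fun x y h => by
  obtain ⟨k, hk, hy⟩ := exists_growth_eq n y
  rw [hy]
  exact (growth_le_growthLine hk x).trans (growthLine_mono n k h)

theorem growth_concaveOn (n : ℕ) : ConcaveOn ℝ Set.univ (growth n) := by
  refine ⟨convex_univ, fun x _ y _ a b ha hb hab => ?_⟩
  obtain ⟨k, hk, h⟩ := exists_growth_eq n (a • x + b • y)
  have hx := mul_le_mul_of_nonneg_left (growth_le_growthLine hk x) ha
  have hy := mul_le_mul_of_nonneg_left (growth_le_growthLine hk y) hb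
  rw [h]
  obtain rfl : b = 1 - a := by linarith
  simp only [smul_eq_mul, growthLine] at *
  linarith

/-- Both `x` and `y` lie between `a` and `b`, and they are convex combinations of these with the two
weights exchanged. -/
theorem growth_add_le_of_concave (n : ℕ) {a b x y : ℝ} (hax : a ≤ x) (hay : a ≤ y)
    (h : a + b = x + y) : growth n a + growth n b ≤ growth n x + growth n y := by
  rcases (show a ≤ b by linarith).eq_or_lt with hab | hab
  · obtain rfl : x = a := by linarith
    obtain rfl : y = b := by linarith
    rfl
  have hd : 0 < b - a := by linarith
  have hne : b - a ≠ 0 := hd.ne'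
  have hs : (b - x) / (b - a) + (x - a) / (b - a) = 1 := by field_simp; ring
  have h1 : 0 ≤ (b - x) / (b - a) := div_nonneg (by linarith) hd.le
  have h2 : 0 ≤ (x - a) / (b - a) := div_nonneg (by linarith) hd.le
  have hx := (growth_concaveOn n).2 (Set.mem_univ a) (Set.mem_univ b) h1 h2 hs
  have hy := (growth_concaveOn n).2 (Set.mem_univ a) (Set.mem_univ b) h2 h1 (by linarith)
  have ex : (b - x) / (b - a) * a + (x - a) / (b - a) * b = x := by field_simp; ring
  have ey : (x - a) / (b - a) * a + (b - x) / (b - a) * b = y := by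
    obtain rfl : y = a + b - x := by linarith
    field_simp
    ring
  simp only [smul_eq_mul] at hx hy
  rw [ex] at hx
  rw [ey] at hy
  generalize (b - x) / (b - a) = s at *
  obtain rfl : s = 1 - (x - a) / (b - a) := by linarith
  linarith

theorem growth_partialBallCard {n k : ℕ} (hk : k ≤ n) {l : ℝ} (hl : l ∈ Set.Icc (0 : ℝ) 1) :
    growth n (partialBallCard n k l) = partialBallCard n (k + 1) l := by
  rw [← growthLine_partialBallCard]
  refine le_antisymm (growth_le_growthLine hk _) ?_
  obtain ⟨j, hj, h⟩ := exists_growth_eq n (partialBallCard n k l)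
  rw [h]
  rcases le_total k j with hkj | hkj
  · exact growthLine_le_of_ge n hkj (partialBallCard_le_succ n k hl.2)
  · exact growthLine_le_of_le n hkj (partialBallCard_zero_le n k hl.1)

/-- The two-point inequality behind the induction on the dimension. -/
theorem growth_succ_le (n : ℕ) {x y : ℝ} (hy : 0 ≤ y) (hyx : y ≤ x) (hx1 : 1 ≤ x)
    (hx : x ≤ 2 ^ n) : growth (n + 1) (x + y) ≤ growth n x + max (growth n y) x := by
  obtain ⟨K, hK, l, hl, hs⟩ := exists_partialBallCard_eq (n + 1) (x := x + y) (by linarith)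
    (by rw [pow_succ]; linarith)
  -- A positive radius is needed for Pascal's rule. Radius `0` gives size `l ≤ 1`, so `1 ≤ x` forces
  -- `x + y = 1`, which is also radius `1` with fraction `0`.
  have key : ∃ k ≤ n, ∃ l ∈ Set.Icc (0 : ℝ) 1, partialBallCard (n + 1) (k + 1) l = x + y := by
    rcases K with _ | k
    · refine ⟨0, Nat.zero_le _, 0, by simp, ?_⟩
      have h1 := hl.2
      simp only [partialBallCard, Finset.range_zero, Finset.sum_empty, Nat.choose_zero_right,
        Nat.cast_one, mul_one, zero_add] at hs
      simp [partialBallCard]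
      linarith
    · exact ⟨k, by omega, l, hl, hs⟩
  obtain ⟨k, hk, l, hl, hs⟩ := key
  have hG1 : growth (n + 1) (x + y) = partialBallCard (n + 1) (k + 2) l := by
    rw [← hs, growth_partialBallCard (by omega) hl]
  have ha := growth_partialBallCard hk hl
  have hb : growth n (partialBallCard n (k + 1) l) = partialBallCard n (k + 2) l := by
    -- For `k = n` both radii exceed `n`, so both sizes are `2^n`, which `growth` fixes.
    rcases hk.eq_or_lt with rfl | hk'
    · have h1 := growth_partialBallCard (le_refl k) (l := 1) (by simp)
      rw [partialBallCard_one, partialBallCard_one] at h1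
      have h2 : ∀ l, partialBallCard k (k + 1 + 1) l = partialBallCard k (k + 1) l := by
        intro l
        simp [partialBallCard, Finset.sum_range_succ, Nat.choose_eq_zero_of_lt]
      rw [show k + 2 = k + 1 + 1 from rfl, h2, partialBallCard_succ_top k l,
        ← partialBallCard_succ_top k 0, h1, h2]
    · exact growth_partialBallCard hk' hl
  rw [partialBallCard_pascal] at hs hG1
  rw [hG1]
  -- Compare `(x, y)` with the Pascal pair `(B_n(k + 1, l), B_n(k, l))` of the same sum. If `y` is
  -- below the smaller member, then `x` is above the larger, and monotonicity suffices with the term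
  -- `x` of the maximum. Otherwise `x, y` are the more balanced pair and concavity applies.
  rcases le_total y (partialBallCard n k l) with h | h
  · have hxb : partialBallCard n (k + 1) l ≤ x := by linarith
    have := growth_mono n hxb
    rw [hb] at this
    have := le_max_right (growth n y) x
    linarith
  · have := growth_add_le_of_concave n (h.trans hyx) h hs
    rw [ha, hb] at this
    have := le_max_left (growth n y) x
    linarith

/-! ### Vertex isoperimetry on the cube. -/

theorem hammingDist_cons {n : ℕ} (b b' : Bool) (x y : Fin n → Bool) :
    hammingDist (Fin.cons b x : Fin (n + 1) → Bool) (Fin.cons b' y) =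
      (if b = b' then 0 else 1) + hammingDist x y := by
  simp only [hammingDist, Finset.card_filter, Fin.sum_univ_succ, Fin.cons_zero, Fin.cons_succ]
  split_ifs <;> simp_all

/-- The points at Hamming distance at most `r` from `A`. -/
def hammingThickening {n : ℕ} (r : ℕ) (A : Finset (Fin n → Bool)) : Finset (Fin n → Bool) :=
  Finset.univ.filter fun x => ∃ y ∈ A, hammingDist x y ≤ r

theorem mem_hammingThickening {n r : ℕ} {A : Finset (Fin n → Bool)} {x : Fin n → Bool} :
    x ∈ hammingThickening r A ↔ ∃ y ∈ A, hammingDist x y ≤ r := by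
  simp [hammingThickening]

theorem subset_hammingThickening {n : ℕ} (r : ℕ) (A : Finset (Fin n → Bool)) :
    A ⊆ hammingThickening r A := fun x hx =>
  mem_hammingThickening.2 ⟨x, hx, by simp⟩

theorem hammingThickening_thickening_subset {n : ℕ} (r s : ℕ) (A : Finset (Fin n → Bool)) :
    hammingThickening s (hammingThickening r A) ⊆ hammingThickening (r + s) A := fun x hx => by
  obtain ⟨y, hy, hxy⟩ := mem_hammingThickening.1 hx
  obtain ⟨z, hz, hyz⟩ := mem_hammingThickening.1 hy
  exact mem_hammingThickening.2 ⟨z, hz, (hammingDist_triangle x y z).trans (by omega)⟩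

/-- The section of `A` where the first coordinate is `b`. -/
def cubeSection {n : ℕ} (b : Bool) (A : Finset (Fin (n + 1) → Bool)) : Finset (Fin n → Bool) :=
  Finset.univ.filter fun x => (Fin.cons b x : Fin (n + 1) → Bool) ∈ A

theorem mem_cubeSection {n : ℕ} {b : Bool} {A : Finset (Fin (n + 1) → Bool)} {x : Fin n → Bool} :
    x ∈ cubeSection b A ↔ (Fin.cons b x : Fin (n + 1) → Bool) ∈ A := by
  simp [cubeSection]

theorem card_cubeSection_add {n : ℕ} (b : Bool) (A : Finset (Fin (n + 1) → Bool)) :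
    (cubeSection b A).card + (cubeSection (!b) A).card = A.card := by
  have h : ∀ b, (cubeSection b A).card = (A.filter fun x => x 0 = b).card := fun b => by
    refine Finset.card_bij (fun x _ => Fin.cons b x) ?_ ?_ ?_
    · intro x hx
      simpa using mem_cubeSection.1 hx
    · intro x _ y _ hxy
      exact Fin.cons_right_injective (α := fun _ => Bool) b hxy
    · intro x hx
      obtain ⟨hxA, rfl⟩ := Finset.mem_filter.1 hx
      exact ⟨Fin.tail x, by simpa [mem_cubeSection] using hxA, by simp⟩
  rw [h, h, ← Finset.card_filter_add_card_filter_not (s := A) (fun x => x 0 = b)]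
  congr 2
  ext x
  cases b <;> simp

theorem thickening_cubeSection_subset {n : ℕ} (b : Bool) (A : Finset (Fin (n + 1) → Bool)) :
    hammingThickening 1 (cubeSection b A) ⊆ cubeSection b (hammingThickening 1 A) := fun x hx => by
  obtain ⟨y, hy, hxy⟩ := mem_hammingThickening.1 hx
  exact mem_cubeSection.2 (mem_hammingThickening.2
    ⟨_, mem_cubeSection.1 hy, by simpa [hammingDist_cons] using hxy⟩)

theorem cubeSection_not_subset {n : ℕ} (b : Bool) (A : Finset (Fin (n + 1) → Bool)) :
    cubeSection b A ⊆ cubeSection (!b) (hammingThickening 1 A) := fun x hx =>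
  mem_cubeSection.2 (mem_hammingThickening.2
    ⟨_, mem_cubeSection.1 hx, by simp [hammingDist_cons]⟩)

/-- A vertex-isoperimetric inequality on the hypercube: a linearly interpolated form of Harper's
theorem. -/
theorem growth_card_le_card_thickening {n : ℕ} {A : Finset (Fin n → Bool)} (hA : A.Nonempty) :
    growth n A.card ≤ (hammingThickening 1 A).card := by
  induction n with
  | zero =>
    have h1 : A.card = 1 := le_antisymm (by simpa using A.card_le_univ) hA.card_pos
    have h2 : A.card ≤ (hammingThickening 1 A).card :=
      Finset.card_le_card (subset_hammingThickening 1 A)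
    have h3 := growth_le_growthLine (le_refl 0) (A.card : ℝ)
    rw [h1] at h2 h3 ⊢
    refine h3.trans ?_
    simpa [growthLine, growthSlope, partialBallCard] using h2
  | succ n ih =>
    obtain ⟨b, hb⟩ : ∃ b, (cubeSection (!b) A).card ≤ (cubeSection b A).card := by
      rcases le_total (cubeSection true A).card (cubeSection false A).card with h | h
      · exact ⟨false, h⟩
      · exact ⟨true, h⟩
    have hsum := card_cubeSection_add b A
    have hpos := hA.card_pos
    have hb1 : 1 ≤ (cubeSection b A).card := by omega
    have hle : (cubeSection b A).card ≤ 2 ^ n := by simpa using (cubeSection b A).card_le_univ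
    have h1 := (ih (Finset.card_pos.1 hb1)).trans
      (Nat.cast_le.2 (Finset.card_le_card (thickening_cubeSection_subset b A)))
    have h2 : ((cubeSection b A).card : ℝ) ≤ (cubeSection (!b) (hammingThickening 1 A)).card :=
      Nat.cast_le.2 (Finset.card_le_card (cubeSection_not_subset b A))
    have hmain : growth (n + 1) ((cubeSection b A).card + (cubeSection (!b) A).card) ≤
        growth n (cubeSection b A).card + (cubeSection (!b) (hammingThickening 1 A)).card := by
      -- The induction hypothesis fails for an empty section, because `growth n 0 = 1`; there the
      -- maximum is still at most the opposite section's contribution, which is at least `1`.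
      rcases (cubeSection (!b) A).eq_empty_or_nonempty with he | he
      · have h0 : growth n 0 = 1 := by
          have := growth_partialBallCard (Nat.zero_le n) (l := 0) (by simp)
          simpa [partialBallCard] using this
        refine (growth_succ_le n (by positivity) (by exact_mod_cast hb) (by exact_mod_cast hb1)
          (by exact_mod_cast hle)).trans ?_
        gcongr
        refine max_le ?_ h2
        rw [he, Finset.card_empty, Nat.cast_zero, h0]
        exact le_trans (by exact_mod_cast hb1) h2
      · refine (growth_succ_le n (by positivity) (by exact_mod_cast hb) (by exact_mod_cast hb1)
          (by exact_mod_cast hle)).trans ?_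
        gcongr
        exact max_le ((ih he).trans (Nat.cast_le.2
          (Finset.card_le_card (thickening_cubeSection_subset (!b) A)))) h2
    rw [← card_cubeSection_add b A, ← card_cubeSection_add b (hammingThickening 1 A)]
    push_cast
    linarith

theorem partialBallCard_le_card_thickening {n : ℕ} {A : Finset (Fin n → Bool)} (hA : A.Nonempty)
    {k : ℕ} {l : ℝ} (hl : l ∈ Set.Icc (0 : ℝ) 1) (hcard : partialBallCard n k l ≤ A.card) {r : ℕ}
    (hr : k + r ≤ n + 1) : partialBallCard n (k + r) l ≤ (hammingThickening r A).card := by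
  induction r with
  | zero =>
    exact hcard.trans (Nat.cast_le.2 (Finset.card_le_card (subset_hammingThickening 0 A)))
  | succ r ih =>
    calc partialBallCard n (k + (r + 1)) l = growth n (partialBallCard n (k + r) l) :=
          (growth_partialBallCard (by lia) hl).symm
      _ ≤ growth n (hammingThickening r A).card := growth_mono n (ih (by omega))
      _ ≤ (hammingThickening 1 (hammingThickening r A)).card :=
          growth_card_le_card_thickening (hA.mono (subset_hammingThickening r A))
      _ ≤ (hammingThickening (r + 1) A).card :=
          Nat.cast_le.2 (Finset.card_le_card (hammingThickening_thickening_subset r 1 A))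

/-! ### From isoperimetry to robustness. -/

theorem uniformCube_real (n : ℕ) (A : Finset (Cube n)) :
    (uniformCube n).real A = A.card / 2 ^ n := by
  rw [uniformCube, Measure.real, PMF.toMeasure_uniformOfFintype_apply _ (by trivial)]
  have : Fintype.card (Cube n) = 2 ^ n := by
    change Fintype.card (Fin n → Bool) = 2 ^ n
    simp
  simp [this]

/-- If `d` is the least radius at which the thickening of `A` reaches `x`, exactly the indicators
with `r < d` equal `1`. A nearest point of `A` witnesses that the error distance is at most `d`. -/
theorem errorDist_le_sum {n : ℕ} {Y : Type*} (h c : Cube n → Y) (A : Finset (Fin n → Bool))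
    (hA : ∀ x ∈ A, h (Hamming.toHamming x) ≠ c (Hamming.toHamming x)) {m : ℕ}
    (hm : hammingThickening m A = Finset.univ) (x : Cube n) :
    ClassificationProblem.errorDist h c x ≤
      ∑ r ∈ Finset.range (m + 1),
        Set.indicator {x : Cube n | Hamming.ofHamming x ∉ hammingThickening r A} 1 x := by
  classical
  have hex : ∃ d, Hamming.ofHamming x ∈ hammingThickening d A := ⟨m, hm ▸ Finset.mem_univ _⟩
  set d := Nat.find hex with hd
  have hdm : d ≤ m := Nat.find_min' hex (hm ▸ Finset.mem_univ _)
  obtain ⟨y, hy, hxy⟩ := mem_hammingThickening.1 (Nat.find_spec hex)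
  calc ClassificationProblem.errorDist h c x ≤ ((d : ℝ≥0) : ℝ≥0∞) := by
        refine iInf₂_le (d : ℝ≥0) ⟨Hamming.toHamming y, ?_, hA y hy⟩
        rw [Metric.mem_closedBall', Hamming.dist_eq_hammingDist]
        exact_mod_cast hxy
    _ = ∑ r ∈ Finset.range d,
        Set.indicator {x : Cube n | Hamming.ofHamming x ∉ hammingThickening r A} 1 x := by
        rw [Finset.sum_congr rfl (g := fun _ => (1 : ℝ≥0∞))]
        · simp
        · intro r hr
          have hmem : x ∈ {x : Cube n | Hamming.ofHamming x ∉ hammingThickening r A} :=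
            Nat.find_min hex (Finset.mem_range.1 hr)
          rw [Set.indicator_of_mem hmem, Pi.one_apply]
    _ ≤ _ := Finset.sum_le_sum_of_subset (Finset.range_mono (by omega))

end

theorem mainTheorem2 (n : ℕ) {Y : Type*} (P : ClassificationProblem (Cube n) Y)
    (hP : P.distribution = uniformCube n)
    (h : Cube n → Y) (hh : h ∈ P.hypotheses) (c : Cube n → Y) (hc : c ∈ P.concepts)
    (hrisk : 0 < P.risk h c)
    (k : ℕ) (l : ℝ) (hkl : (k, l) = BSizeInv n (P.risk h c)) :
    P.robER h c ≤
      ENNReal.ofReal (∑ r ∈ Finset.range ((n + 1 - k) + 1), (1 - BSize n (k + r) l)) := by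
  classical
  have hpow : (0 : ℝ) < 2 ^ n := by positivity
  have : IsProbabilityMeasure (uniformCube n) := hP ▸ P.isProbabilityMeasure
  let A : Finset (Cube n) := Finset.univ.filter fun x => h x ≠ c x
  have hAset : ({x | h x ≠ c x} : Set (Cube n)) = A := by ext; simp [A]
  have hmu : P.risk h c = A.card / 2 ^ n := by
    rw [ClassificationProblem.risk, hP, hAset, uniformCube_real]
  have hmu1 : P.risk h c ≤ 1 := by
    rw [ClassificationProblem.risk, hP]
    exact measureReal_le_one
  obtain ⟨hdom, hsize⟩ := (BSizeInv_eq_iff n ⟨hrisk.le, hmu1⟩ k l).1 hkl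
  have hl : l ∈ Set.Icc (0 : ℝ) 1 ∧ k ≤ n + 1 := by
    rcases hdom with hd | hd
    · exact ⟨⟨hd.2.1, hd.2.2.le⟩, hd.1.trans n.le_succ⟩
    · obtain ⟨rfl, rfl⟩ := Prod.mk.inj hd
      simp
  obtain ⟨hl, hk⟩ := hl
  have hA : A.Nonempty := by
    rw [hmu] at hrisk
    exact Finset.card_pos.1 (by exact_mod_cast (div_pos_iff_of_pos_right hpow).1 hrisk)
  have hcard : partialBallCard n k l ≤ A.card := by
    rw [partialBallCard_eq_BSize, hsize, hmu]
    exact (mul_div_cancel₀ _ hpow.ne').le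
  have hiso : ∀ r ≤ n + 1 - k, partialBallCard n (k + r) l ≤ (hammingThickening r A).card :=
    fun r hr => partialBallCard_le_card_thickening hA hl hcard (by omega)
  -- At radius `n + 1` the partial ball is the whole cube, so every point has been reached and the
  -- sum can stop here.
  have huniv : hammingThickening (n + 1 - k) A = Finset.univ := by
    have h1 := hiso _ le_rfl
    rw [Nat.add_sub_cancel' hk, partialBallCard_succ_top] at h1
    refine Finset.eq_univ_of_card _ (le_antisymm (Finset.card_le_univ _) ?_)
    simpa using (by exact_mod_cast h1 : 2 ^ n ≤ (hammingThickening (n + 1 - k) A).card)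
  have hmeas : ∀ r, uniformCube n {x | Hamming.ofHamming x ∉ hammingThickening r A} =
      ENNReal.ofReal (1 - (hammingThickening r A).card / 2 ^ n) := fun r => by
    let B : Finset (Cube n) := hammingThickening r A
    change uniformCube n (B : Set (Cube n))ᶜ = ENNReal.ofReal (1 - B.card / 2 ^ n)
    rw [← uniformCube_real n B, ← probReal_compl_eq_one_sub (by trivial),
      ofReal_measureReal]
  have hle : ∀ r ∈ Finset.range (n + 1 - k + 1),
      1 - ((hammingThickening r A).card : ℝ) / 2 ^ n ≤ 1 - BSize n (k + r) l := fun r hr => by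
    have h1 := hiso r (by simp at hr; omega)
    rw [partialBallCard_eq_BSize] at h1
    have := (le_div_iff₀' hpow).2 h1
    linarith
  have hnonneg : ∀ r, 0 ≤ 1 - ((hammingThickening r A).card : ℝ) / 2 ^ n := fun r => by
    have h1 : (hammingThickening r A).card ≤ 2 ^ n := by
      simpa using (hammingThickening r A).card_le_univ
    exact sub_nonneg.2 ((div_le_one hpow).2 (by exact_mod_cast h1))
  calc P.robER h c ≤ ∫⁻ x, ∑ r ∈ Finset.range (n + 1 - k + 1),
        Set.indicator {x : Cube n | Hamming.ofHamming x ∉ hammingThickening r A} 1 x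
          ∂(uniformCube n) := by
        rw [ClassificationProblem.robER, hP]
        exact lintegral_mono (errorDist_le_sum h c A (fun x hx => (Finset.mem_filter.1 hx).2) huniv)
    _ = ∑ r ∈ Finset.range (n + 1 - k + 1),
        ENNReal.ofReal (1 - (hammingThickening r A).card / 2 ^ n) := by
        rw [lintegral_finsetSum _ fun r _ => measurable_of_finite _]
        exact Finset.sum_congr rfl fun r _ => by
          rw [lintegral_indicator_one (by trivial), hmeas]
    _ ≤ ∑ r ∈ Finset.range (n + 1 - k + 1), ENNReal.ofReal (1 - BSize n (k + r) l) :=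
        Finset.sum_le_sum fun r hr => ENNReal.ofReal_le_ofReal (hle r hr)
    -- `ENNReal.ofReal` truncates negative values, so each summand must be nonnegative; it dominates
    -- the measure of a complement.
    _ = _ := (ENNReal.ofReal_sum_of_nonneg fun r hr => (hnonneg r).trans (hle r hr)).symm
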